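/- For $n \ge 1$ let $Q_n$ be the $n$-dimensional hypercube: its vertices are the binary $n$-tuples, and two vertices are adjacent if and only if they differ in exactly one coordinate. A decomposition of a graph is a family of subgraphs such that every edge of the graph belongs to exactly one of them. The length of a cycle or path is its number of edges. **Theorem.** Let $m \ge 1$ and let $n \ge 2^m$ be an even integer. Put $r = 2^{n-1-m}$. Then $Q_n$ has a decomposition into $r$ cycles $C_1, \dots, C_r$, each of length $2^m n$, such that (I) every $C_i$ contains $2^m$ distinct edges $e_{i1}, e_{i2}, \dots, e_{i2^m}$ such that the graph $C_i - \{e_{i1}, \dots, e_{i2^m}\}$ (these edges are deleted, all vertices are kept) has exactly $2^m$ connected components, each of which is a path of length $n-1$; and (II) the set $M = \{e_{ij} : 1 \le i \le r,\ 1 \le j \le 2^m\}$ is a perfect matching of $Q_n$. -/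

import Mathlib

/-- The `n`-cube `Q_n`: the vertices are the binary `n`-tuples, and two of them are adjacent when
they differ in exactly one coordinate. -/
def cube (n : ℕ) : SimpleGraph (Fin n → Bool) where
  Adj x y := ∃! i, x i ≠ y i
  symm := ⟨fun _ _ ⟨i, hi, hu⟩ => ⟨i, hi.symm, fun j hj => hu j hj.symm⟩⟩
  loopless := ⟨fun _ ⟨_, hi, _⟩ => hi rfl⟩

/-- A family of subgraphs of `G` is a decomposition of `G` if every edge of `G` belongs to exactly
one member of the family. -/
def IsDecomposition {V ι : Type*} {G : SimpleGraph V} (C : ι → G.Subgraph) : Prop :=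
  ∀ e ∈ G.edgeSet, ∃! i, e ∈ (C i).edgeSet

/-- A `k`-cycle: a graph isomorphic to the cycle with `k` edges (`k ≥ 3`). -/
def IsCycleOfLength {V : Type*} (G : SimpleGraph V) (k : ℕ) : Prop :=
  3 ≤ k ∧ Nonempty (G ≃g SimpleGraph.cycleGraph k)

/-- A `k`-path: a graph isomorphic to the path with `k` edges (so `k + 1` vertices). -/
def IsPathOfLength {V : Type*} (G : SimpleGraph V) (k : ℕ) : Prop :=
  Nonempty (G ≃g SimpleGraph.pathGraph (k + 1))

/-! Everything reduces to building closed walks, the structure `SegmentedCycles`: each has period `k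
* n` with no repetition inside a period, every edge of the cube is traversed, and cutting the walks
into segments of `n` vertices makes every even vertex the start of a segment and every odd vertex
the end of one. If there are `2 ^ (n - 1) / k` walks, the numbers of traversals and of segment ends
equal those of edges and vertices, so covering forces uniqueness. Thus the walks decompose the cube,
and the edges joining consecutive segments form the perfect matching (`edge_unique`,
`marked_unique`).

The walks come by induction on the exponent of `k`. For `k = 2`, flip the coordinates cyclically;
for `n = k = 4`, take two explicit Hamiltonian cycles. The inductive step `SegmentedCycles.prod`
goes from `(n, k)` to `(4 + n, 2 * k)`: a segment makes four steps along a Hamiltonian cycle of the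
`4`-cube and then traverses one old segment. After `k` segments the second coordinate has closed up,
while the first must be at the antipode of its `16`-cycle, so that the walk closes after exactly `2
* k` segments. For `k = 2` forward quarters already achieve this; for `4 ∣ k` one quarter in each
`k` is run backward. -/

/-! ### Closed vertex sequences and the cycles they trace -/

/-- The subgraph traced by a sequence of successively adjacent vertices. -/
def traceSubgraph {V : Type*} {G : SimpleGraph V} (c : ℕ → V)
    (h : ∀ t, G.Adj (c t) (c (t + 1))) : G.Subgraph where
  verts := Set.range c
  Adj x y := ∃ t, s(x, y) = s(c t, c (t + 1))
  adj_sub := by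
    rintro x y ⟨t, ht⟩
    rw [← SimpleGraph.mem_edgeSet, ht]
    exact h t
  edge_vert := by
    rintro x y ⟨t, ht⟩
    rcases Sym2.eq_iff.1 ht with ⟨rfl, -⟩ | ⟨rfl, -⟩ <;> exact ⟨_, rfl⟩
  symm := ⟨fun x y ⟨t, ht⟩ => ⟨t, by rw [Sym2.eq_swap, ht]⟩⟩

theorem mem_edgeSet_traceSubgraph {V : Type*} {G : SimpleGraph V} (c : ℕ → V)
    (h : ∀ t, G.Adj (c t) (c (t + 1))) (e : Sym2 V) :
    e ∈ (traceSubgraph c h).edgeSet ↔ ∃ t, e = s(c t, c (t + 1)) := by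
  induction e with
  | _ x y => rw [SimpleGraph.Subgraph.mem_edgeSet]; rfl

theorem isCycleOfLength_traceSubgraph {V : Type*} {G : SimpleGraph V} (c : ℕ → V)
    (h : ∀ t, G.Adj (c t) (c (t + 1))) {L : ℕ} (hL : 3 ≤ L)
    (hc : ∀ t t', c t = c t' ↔ t ≡ t' [MOD L]) :
    IsCycleOfLength (traceSubgraph c h).coe L := by
  refine ⟨hL, ?_⟩
  obtain ⟨l, rfl⟩ : ∃ l, L = l + 2 := ⟨L - 2, by omega⟩
  have hbij : Function.Bijective
      (fun u : Fin (l + 2) => (⟨c u, u, rfl⟩ : (traceSubgraph c h).verts)) := by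
    constructor
    · intro u v huv
      have := (hc _ _).1 (Subtype.ext_iff.1 huv)
      exact Fin.ext (Nat.ModEq.eq_of_lt_of_lt this u.2 v.2)
    · rintro ⟨_, t, rfl⟩
      refine ⟨⟨t % (l + 2), Nat.mod_lt _ (by omega)⟩, Subtype.ext ((hc _ _).2 (Nat.mod_modEq _ _))⟩
  have hsucc : ∀ (u v : Fin (l + 2)), v = u + 1 ↔ (v : ℕ) ≡ u + 1 [MOD l + 2] := by
    intro u v
    rw [Fin.ext_iff, Fin.val_add, Nat.ModEq, Nat.mod_eq_of_lt v.2]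
    simp
  refine ⟨(RelIso.symm ⟨Equiv.ofBijective _ hbij, ?_⟩)⟩
  intro u v
  rw [SimpleGraph.cycleGraph_adj, sub_eq_iff_eq_add, sub_eq_iff_eq_add, add_comm 1 v, add_comm 1 u,
    hsucc, hsucc]
  change (∃ t, s(c u, c v) = s(c t, c (t + 1))) ↔ _
  constructor
  · rintro ⟨t, ht⟩
    rcases Sym2.eq_iff.1 ht with ⟨h1, h2⟩ | ⟨h1, h2⟩
    · rw [hc] at h1 h2
      exact Or.inr (h2.trans (h1.symm.add_right 1))
    · rw [hc] at h1 h2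
      exact Or.inl (h1.trans (h2.symm.add_right 1))
  · rintro (h1 | h1)
    · exact ⟨v, by rw [(hc _ _).2 h1, Sym2.eq_swap]⟩
    · exact ⟨u, by rw [(hc _ _).2 h1]⟩

/-- A graph that is a disjoint union of `k` paths on `n` vertices has `k` components, and they are
paths of length `n - 1`. -/
theorem components_of_disjoint_paths {W : Type*} (H : SimpleGraph W) {k n : ℕ} (hn : 1 ≤ n)
    (φ : Fin k × Fin n ≃ W)
    (hφ : ∀ j a j' a', H.Adj (φ (j, a)) (φ (j', a')) ↔
      j = j' ∧ ((a : ℕ) + 1 = a' ∨ (a' : ℕ) + 1 = a)) :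
    Nat.card H.ConnectedComponent = k ∧
      ∀ c : H.ConnectedComponent, IsPathOfLength c.toSimpleGraph (n - 1) := by
  obtain ⟨n, rfl⟩ : ∃ l, n = l + 1 := ⟨n - 1, by omega⟩
  have hblk : ∀ w w' : W, H.Reachable w w' → (φ.symm w).1 = (φ.symm w').1 := by
    rintro w w' ⟨p⟩
    induction p with
    | nil => rfl
    | cons hadj _ ih =>
      refine Eq.trans ?_ ih
      rename_i u v _ _
      exact ((hφ (φ.symm u).1 (φ.symm u).2 (φ.symm v).1 (φ.symm v).2).1 (by simpa using hadj)).1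
  have hreach : ∀ j a a', H.Reachable (φ (j, a)) (φ (j, a')) := by
    intro j a a'
    let f : SimpleGraph.pathGraph (n + 1) →g H :=
      ⟨fun b => φ (j, b), by
        intro b b' hb
        rw [SimpleGraph.pathGraph_adj] at hb
        exact (hφ _ _ _ _).2 ⟨rfl, hb⟩⟩
    exact (SimpleGraph.pathGraph_preconnected (n + 1) a a').map f
  constructor
  · have hbij : Function.Bijective (fun j => H.connectedComponentMk (φ (j, 0))) := by
      constructor
      · intro j j' hj
        simpa using hblk _ _ (SimpleGraph.ConnectedComponent.exact hj)
      · intro c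
        induction c using SimpleGraph.ConnectedComponent.ind with
        | _ w =>
          refine ⟨(φ.symm w).1, SimpleGraph.ConnectedComponent.sound ?_⟩
          have := hreach (φ.symm w).1 0 (φ.symm w).2
          simpa using this
    rw [← Nat.card_congr (Equiv.ofBijective _ hbij), Nat.card_fin]
  · intro c
    induction c using SimpleGraph.ConnectedComponent.ind with
    | _ w =>
      obtain ⟨⟨j, a₀⟩, rfl⟩ := φ.surjective w
      have hmem : ∀ a, φ (j, a) ∈ H.connectedComponentMk (φ (j, a₀)) := fun a =>
        SimpleGraph.ConnectedComponent.sound (hreach _ _ _)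
      have hbij : Function.Bijective (fun a : Fin (n + 1) =>
          (⟨φ (j, a), hmem a⟩ : H.connectedComponentMk (φ (j, a₀)))) := by
        constructor
        · intro a a' h
          simpa using h
        · rintro ⟨x, hx⟩
          obtain ⟨⟨j', a⟩, rfl⟩ := φ.surjective x
          have : j' = j := by
            simpa using hblk _ _ (SimpleGraph.ConnectedComponent.exact hx)
          subst this
          exact ⟨a, rfl⟩
      refine ⟨RelIso.symm ⟨Equiv.ofBijective _ hbij, ?_⟩⟩
      intro a a'
      rw [SimpleGraph.pathGraph_adj]
      exact (hφ j a j a').trans (by simp)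

/-! ### Families of closed sequences in the cube -/

/-- The parity of the number of ones of a binary tuple. -/
def parity {n : ℕ} (x : Fin n → Bool) : ZMod 2 := ∑ i, if x i then 1 else 0

theorem parity_eq_zero_or_one {n : ℕ} (x : Fin n → Bool) : parity x = 0 ∨ parity x = 1 := by
  generalize parity x = p
  revert p
  decide

/-- `x` with its `d`-th entry changed. -/
def flipAt {n : ℕ} (d : Fin n) (x : Fin n → Bool) : Fin n → Bool := Function.update x d (!x d)

theorem cube_adj_iff {n : ℕ} {x y : Fin n → Bool} : (cube n).Adj x y ↔ ∃ d, y = flipAt d x := by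
  constructor
  · rintro ⟨d, hd, hu⟩
    refine ⟨d, funext fun j => ?_⟩
    by_cases hj : j = d
    · subst hj
      simp only [flipAt, Function.update_self]
      cases h1 : x j <;> cases h2 : y j <;> simp_all
    · simp only [flipAt, Function.update_of_ne hj]
      by_contra hne
      exact hj (hu j (Ne.symm hne))
  · rintro ⟨d, rfl⟩
    refine ⟨d, by simp [flipAt], fun j hj => ?_⟩
    by_contra hne
    simp [flipAt, Function.update_of_ne hne] at hj

theorem flipAt_injective {n : ℕ} (x : Fin n → Bool) : Function.Injective fun d => flipAt d x := by
  intro d d' h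
  by_contra hne
  have := congrFun h d
  simp [flipAt, Function.update_of_ne hne] at this

/-- A family of closed vertex sequences of the `n`-cube, each tracing a cycle of length `k * n`, that
covers all edges and whose vertices at the times congruent to `0` (to `-1`) modulo `n` are all the
even (odd) vertices. -/
structure SegmentedCycles {n : ℕ} (k : ℕ) {ι : Type} (c : ι → ℕ → Fin n → Bool) : Prop where
  adj : ∀ i t, (cube n).Adj (c i t) (c i (t + 1))
  eq_iff : ∀ i t t', c i t = c i t' ↔ t ≡ t' [MOD k * n]
  edge : ∀ x y, (cube n).Adj x y → ∃ i t, s(x, y) = s(c i t, c i (t + 1))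
  even : ∀ x, parity x = 0 → ∃ i j, x = c i (j * n)
  odd : ∀ x, parity x = 1 → ∃ i j, x = c i (j * n + (n - 1))

namespace SegmentedCycles

variable {n k : ℕ} {ι : Type} {c : ι → ℕ → Fin n → Bool}

/-- Double counting: there are as many triples (walk, time modulo the period, orientation) as
directed edges, so a covering of the directed edges is a bijection. Orientations are tracked to
exclude an edge traversed in opposite directions. -/
theorem edge_unique [Fintype ι] (hc : SegmentedCycles k c) (hn : 2 ≤ n) (hk : 1 ≤ k)
    (hcard : Fintype.card ι * k = 2 ^ (n - 1)) {i i' : ι} {t t' : ℕ}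
    (h : s(c i t, c i (t + 1)) = s(c i' t', c i' (t' + 1))) : i = i' ∧ t ≡ t' [MOD k * n] := by
  have hpos : 0 < k * n := by positivity
  let tail : ι × Fin (k * n) × Bool → Fin n → Bool :=
    fun p => if p.2.2 then c p.1 (p.2.1 + 1) else c p.1 p.2.1
  let head : ι × Fin (k * n) × Bool → Fin n → Bool :=
    fun p => if p.2.2 then c p.1 p.2.1 else c p.1 (p.2.1 + 1)
  have hper : ∀ i t, c i (t % (k * n)) = c i t := fun i t => (hc.eq_iff _ _ _).2 (Nat.mod_modEq _ _)
  have hper1 : ∀ i t, c i (t % (k * n) + 1) = c i (t + 1) := fun i t =>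
    (hc.eq_iff _ _ _).2 ((Nat.mod_modEq _ _).add_right 1)
  have hex : ∀ q : (Fin n → Bool) × Fin n, ∃ p, tail p = q.1 ∧ head p = flipAt q.2 q.1 := by
    rintro ⟨x, d⟩
    obtain ⟨i, t, ht⟩ := hc.edge x (flipAt d x) (cube_adj_iff.2 ⟨d, rfl⟩)
    rcases Sym2.eq_iff.1 ht with ⟨h1, h2⟩ | ⟨h1, h2⟩
    · refine ⟨(i, ⟨t % (k * n), Nat.mod_lt _ hpos⟩, false), ?_, ?_⟩
      · simp [tail, hper, h1]
      · simp [head, hper1, h2]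
    · refine ⟨(i, ⟨t % (k * n), Nat.mod_lt _ hpos⟩, true), ?_, ?_⟩
      · simp [tail, hper1, h1]
      · simp [head, hper, h2]
  -- `g` selects a traversal of each directed edge. It is injective, hence by cardinality
  -- surjective, so every traversal is determined by its tail and head.
  choose g hg1 hg2 using hex
  have hinj : Function.Injective g := by
    rintro ⟨x, d⟩ ⟨x', d'⟩ h
    have h1 : x = x' := (hg1 (x, d)).symm.trans (h ▸ hg1 (x', d'))
    subst h1
    have h2 : flipAt d x = flipAt d' x := (hg2 (x, d)).symm.trans (h ▸ hg2 (x, d'))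
    rw [flipAt_injective x h2]
  have hsurj : Function.Surjective g := by
    refine ((Fintype.bijective_iff_injective_and_card g).2 ⟨hinj, ?_⟩).2
    obtain ⟨l, rfl⟩ : ∃ l, n = l + 1 := ⟨n - 1, by omega⟩
    simp only [Fintype.card_prod, Fintype.card_fun, Fintype.card_bool, Fintype.card_fin]
    calc 2 ^ (l + 1) * (l + 1) = (2 ^ (l + 1 - 1)) * (l + 1) * 2 := by
          rw [Nat.add_sub_cancel, pow_succ]; ring
      _ = _ := by rw [← hcard]; ring
  have hpair : ∀ p p', tail p = tail p' → head p = head p' → p = p' := by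
    intro p p' h1 h2
    obtain ⟨q, rfl⟩ := hsurj p
    obtain ⟨q', rfl⟩ := hsurj p'
    rw [hg1, hg1] at h1
    rw [hg2, hg2, h1] at h2
    rw [Prod.ext h1 (flipAt_injective _ h2)]
  rcases Sym2.eq_iff.1 h with ⟨h1, h2⟩ | ⟨h1, h2⟩
  · have := hpair (i, ⟨t % (k * n), Nat.mod_lt _ hpos⟩, false)
      (i', ⟨t' % (k * n), Nat.mod_lt _ hpos⟩, false)
      (by simp [tail, hper, h1]) (by simp [head, hper1, h2])
    simp only [Prod.mk.injEq, Fin.mk.injEq, and_true] at this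
    exact this
  · have := hpair (i, ⟨t % (k * n), Nat.mod_lt _ hpos⟩, false)
      (i', ⟨t' % (k * n), Nat.mod_lt _ hpos⟩, true)
      (by simp [tail, hper, hper1, h1]) (by simp [head, hper, hper1, h2])
    simp at this

theorem exists_marked (hc : SegmentedCycles k c) (x : Fin n → Bool) :
    ∃ i j, x = c i (j * n) ∨ x = c i (j * n + (n - 1)) := by
  rcases parity_eq_zero_or_one x with h | h
  · obtain ⟨i, j, h⟩ := hc.even x h
    exact ⟨i, j, Or.inl h⟩
  · obtain ⟨i, j, h⟩ := hc.odd x h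
    exact ⟨i, j, Or.inr h⟩

/-- The starts and ends of segments number `2 * 2 ^ (n - 1)` and cover all `2 ^ n` vertices, so no
vertex is marked twice. -/
theorem marked_unique [Fintype ι] (hc : SegmentedCycles k c) (hn : 2 ≤ n) (hk : 1 ≤ k)
    (hcard : Fintype.card ι * k = 2 ^ (n - 1)) {i i' : ι} {j j' : ℕ} {b b' : Bool}
    (h : c i (j * n + if b then n - 1 else 0) = c i' (j' * n + if b' then n - 1 else 0)) :
    i = i' ∧ j ≡ j' [MOD k] ∧ b = b' := by
  let f : ι × Fin k × Bool → Fin n → Bool :=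
    fun p => c p.1 (p.2.1 * n + if p.2.2 then n - 1 else 0)
  have hper : ∀ i j a, c i (j % k * n + a) = c i (j * n + a) := fun i j a =>
    (hc.eq_iff _ _ _).2 (((Nat.mod_modEq j k).mul_right' n).add_right a)
  have hsurj : Function.Surjective f := by
    intro x
    obtain ⟨i, j, h | h⟩ := hc.exists_marked x
    · refine ⟨(i, ⟨j % k, Nat.mod_lt _ hk⟩, false), ?_⟩
      simp only [f, hper]
      simp [h]
    · refine ⟨(i, ⟨j % k, Nat.mod_lt _ hk⟩, true), ?_⟩
      simp only [f, hper]
      simp [h]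
  have hinj : Function.Injective f := by
    refine ((Fintype.bijective_iff_surjective_and_card f).2 ⟨hsurj, ?_⟩).1
    obtain ⟨l, rfl⟩ : ∃ l, n = l + 1 := ⟨n - 1, by omega⟩
    simp only [Fintype.card_prod, Fintype.card_fun, Fintype.card_bool, Fintype.card_fin]
    rw [← mul_assoc, hcard, Nat.add_sub_cancel, pow_succ]
  have := @hinj (i, ⟨j % k, Nat.mod_lt _ hk⟩, b) (i', ⟨j' % k, Nat.mod_lt _ hk⟩, b')
    (by simp only [f, hper]; exact h)
  simp only [Prod.mk.injEq, Fin.mk.injEq] at this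
  exact this

theorem deleteEdges_components (hc : SegmentedCycles k c) (hn : 2 ≤ n) (hk : 1 ≤ k)
    (hkn : 3 ≤ k * n) (i : ι) :
    Nat.card ((traceSubgraph (c i) (hc.adj i)).deleteEdges (Set.range fun j : Fin k =>
        s(c i (j * n + (n - 1)), c i (j * n + n)))).coe.ConnectedComponent = k ∧
      ∀ C : ((traceSubgraph (c i) (hc.adj i)).deleteEdges (Set.range fun j : Fin k =>
        s(c i (j * n + (n - 1)), c i (j * n + n)))).coe.ConnectedComponent,
        IsPathOfLength C.toSimpleGraph (n - 1) := by
  have hsucc : ∀ j : ℕ, j * n + n = j * n + (n - 1) + 1 := fun j => by omega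
  have hedge : ∀ t t', s(c i t, c i (t + 1)) = s(c i t', c i (t' + 1)) → t ≡ t' [MOD k * n] := by
    intro t t' h
    rcases Sym2.eq_iff.1 h with ⟨h1, h2⟩ | ⟨h1, h2⟩
    · exact (hc.eq_iff _ _ _).1 h1
    -- Traversing one edge in both directions would give period dividing `2`, but the period is at
    -- least `3`.
    · exfalso
      rw [hc.eq_iff] at h1 h2
      have h3 : t' + 2 ≡ t' + 0 [MOD k * n] := (h1.symm.add_right 1).trans h2
      have := Nat.le_of_dvd (by omega) ((Nat.modEq_zero_iff_dvd).1 (Nat.ModEq.add_left_cancel' _ h3))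
      omega
  have hblk : ∀ (j j' : Fin k) (a a' : ℕ), a < n → a' < n →
      j * n + a ≡ j' * n + a' [MOD k * n] → j = j' ∧ a = a' := by
    intro j j' a a' ha ha' h
    have hlt : ∀ (j : Fin k) (a : ℕ), a < n → j * n + a < k * n := by
      intro j a ha
      calc j * n + a < (j + 1) * n := by rw [add_mul, one_mul]; omega
        _ ≤ k * n := Nat.mul_le_mul_right _ j.2
    have h := Nat.ModEq.eq_of_lt_of_lt h (hlt j a ha) (hlt j' a' ha')
    have h1 : (a : ℕ) = a' := by
      have := congrArg (· % n) h
      simpa [Nat.mod_eq_of_lt ha, Nat.mod_eq_of_lt ha'] using this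
    subst h1
    exact ⟨Fin.ext (Nat.eq_of_mul_eq_mul_right (by omega) (Nat.add_right_cancel h)), rfl⟩
  have hbij : Function.Bijective (fun p : Fin k × Fin n =>
      (⟨c i (p.1 * n + p.2), _, rfl⟩ : Set.range (c i))) := by
    constructor
    · rintro ⟨j, a⟩ ⟨j', a'⟩ h
      have h := (hc.eq_iff _ _ _).1 (Subtype.ext_iff.1 h)
      obtain ⟨h1, h2⟩ := hblk j j' a a' a.2 a'.2 h
      rw [h1, Fin.ext h2]
    · rintro ⟨_, t, rfl⟩
      refine ⟨(⟨t / n % k, Nat.mod_lt _ hk⟩, ⟨t % n, Nat.mod_lt _ (by omega)⟩), Subtype.ext ?_⟩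
      refine (hc.eq_iff _ _ _).2 ?_
      have := ((Nat.mod_modEq (t / n) k).mul_right' n).add_right (t % n)
      rwa [Nat.div_add_mod' t n] at this
  refine components_of_disjoint_paths _ (by omega) (Equiv.ofBijective _ hbij) ?_
  have key : ∀ (j : Fin k) (a : Fin n) (j' : Fin k) (a' : Fin n) (t : ℕ),
      j * n + a ≡ t [MOD k * n] → j' * n + a' ≡ t + 1 [MOD k * n] →
      (∀ y : Fin k, s(c i (y * n + (n - 1)), c i (y * n + n)) ≠
        s(c i (j * n + a), c i (j' * n + a'))) → j = j' ∧ (a : ℕ) + 1 = a' := by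
    intro j a j' a' t h1 h2 hne
    have h3 : j' * n + a' ≡ j * n + (a + 1) [MOD k * n] := h2.trans (h1.symm.add_right 1)
    by_cases ha : (a : ℕ) + 1 < n
    · obtain ⟨h4, h5⟩ := hblk j' j a' (a + 1) a'.2 ha h3
      exact ⟨h4.symm, h5.symm⟩
    · exfalso
      have ha : (a : ℕ) = n - 1 := by omega
      apply hne j
      rw [(hc.eq_iff i _ _).2 h3, hsucc, ha]
      rfl
  intro j a j' a'
  change ((∃ t, s(c i (j * n + a), c i (j' * n + a')) = s(c i t, c i (t + 1))) ∧
    s(c i (j * n + a), c i (j' * n + a')) ∉ Set.range fun j : Fin k =>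
        s(c i (j * n + (n - 1)), c i (j * n + n))) ↔ _
  have hmem : ∀ (j : Fin k) (a : Fin n), (a : ℕ) + 1 < n → s(c i (j * n + a), c i (j * n + (a + 1))) ∉
      Set.range fun j : Fin k => s(c i (j * n + (n - 1)), c i (j * n + n)) := by
    rintro j a ha ⟨y, hy⟩
    simp only [hsucc, ← add_assoc] at hy
    have := hblk y j (n - 1) a (by omega) a.2 (hedge _ _ hy)
    omega
  constructor
  · rintro ⟨⟨t, ht⟩, hne⟩
    have hne : ∀ y : Fin k, s(c i (y * n + (n - 1)), c i (y * n + n)) ≠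
        s(c i (j * n + a), c i (j' * n + a')) := fun y hy => hne ⟨y, hy⟩
    rcases Sym2.eq_iff.1 ht with ⟨h1, h2⟩ | ⟨h1, h2⟩
    · rw [hc.eq_iff] at h1 h2
      obtain ⟨h3, h4⟩ := key j a j' a' t h1 h2 hne
      exact ⟨h3, Or.inl h4⟩
    · rw [hc.eq_iff] at h1 h2
      obtain ⟨h3, h4⟩ := key j' a' j a t h2 h1 (fun y hy => hne y (hy.trans Sym2.eq_swap))
      exact ⟨h3.symm, Or.inr h4⟩
  · rintro ⟨rfl, h | h⟩
    · rw [← h]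
      exact ⟨⟨j * n + a, rfl⟩, hmem j a (by omega)⟩
    · rw [← h, Sym2.eq_swap]
      exact ⟨⟨j * n + a', rfl⟩, hmem j a' (by omega)⟩

/-- The edges at the times congruent to `-1` modulo `n`. -/
def matching (c : ι → ℕ → Fin n → Bool) : (cube n).Subgraph where
  verts := Set.univ
  Adj x y := (cube n).Adj x y ∧ ∃ i j, s(x, y) = s(c i (j * n + (n - 1)), c i (j * n + n))
  adj_sub h := h.1
  edge_vert _ := trivial
  symm := ⟨fun _ _ ⟨h, i, j, h'⟩ => ⟨h.symm, i, j, by rw [Sym2.eq_swap, h']⟩⟩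

theorem isPerfectMatching_matching [Fintype ι] (hc : SegmentedCycles k c) (hn : 2 ≤ n) (hk : 1 ≤ k)
    (hcard : Fintype.card ι * k = 2 ^ (n - 1)) : (matching c).IsPerfectMatching := by
  have hsucc : ∀ j : ℕ, j * n + n = j * n + (n - 1) + 1 := fun j => by omega
  have hadj : ∀ i (j : ℕ), (cube n).Adj (c i (j * n + (n - 1))) (c i (j * n + n)) := by
    intro i j
    rw [hsucc]
    exact hc.adj _ _
  have hstart : ∀ i (j : ℕ), c i (j * n + n) = c i ((j + 1) * n) := by
    intro i j
    rw [add_mul, one_mul]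
  refine ⟨fun x _ => ?_, fun _ => trivial⟩
  obtain ⟨i, j, rfl | rfl⟩ := hc.exists_marked x
  -- The start of a segment is matched to the end of the cyclically preceding one; adding `k` avoids
  -- truncated subtraction at `j = 0`.
  · have hpred : ∃ j', j ≡ j' + 1 [MOD k] :=
      ⟨j + k - 1, by rw [show j + k - 1 + 1 = j + k by omega]; simp [Nat.ModEq]⟩
    obtain ⟨j', hj'⟩ := hpred
    have hx : c i (j * n) = c i (j' * n + n) := by
      rw [hstart]
      exact (hc.eq_iff _ _ _).2 (hj'.mul_right' n)
    refine ⟨c i (j' * n + (n - 1)), ⟨?_, i, j', ?_⟩, ?_⟩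
    · rw [hx]; exact (hadj _ _).symm
    · rw [hx, Sym2.eq_swap]
    · rintro y ⟨-, i₂, j₂, h⟩
      rcases Sym2.eq_iff.1 h with ⟨h1, h2⟩ | ⟨h1, h2⟩
      · have := hc.marked_unique hn hk hcard (b := false) (b' := true) (by simpa using h1)
        simp at this
      · rw [hstart] at h1
        obtain ⟨rfl, h3, -⟩ := hc.marked_unique hn hk hcard (b := false) (b' := false)
          (by simpa using h1)
        rw [h2]
        have h4 : j₂ ≡ j' [MOD k] := Nat.ModEq.add_right_cancel' 1 (h3.symm.trans hj')
        exact (hc.eq_iff _ _ _).2 ((h4.mul_right' n).add_right _)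
  · refine ⟨c i (j * n + n), ⟨hadj _ _, i, j, rfl⟩, ?_⟩
    rintro y ⟨-, i₂, j₂, h⟩
    rcases Sym2.eq_iff.1 h with ⟨h1, h2⟩ | ⟨h1, h2⟩
    · obtain ⟨rfl, h3, -⟩ := hc.marked_unique hn hk hcard (b := true) (b' := true)
        (by simpa using h1)
      rw [h2]
      exact (hc.eq_iff _ _ _).2 ((h3.symm.mul_right' n).add_right _)
    · rw [hstart] at h1
      have := hc.marked_unique hn hk hcard (b := true) (b' := false) (by simpa using h1)
      simp at this

theorem mem_edgeSet_matching (hc : SegmentedCycles k c) (hn : 2 ≤ n) (hk : 1 ≤ k)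
    (f : Sym2 (Fin n → Bool)) : f ∈ (matching c).edgeSet ↔
      ∃ (i : ι) (j : Fin k), f = s(c i (j * n + (n - 1)), c i (j * n + n)) := by
  induction f with
  | _ x y =>
    rw [SimpleGraph.Subgraph.mem_edgeSet]
    constructor
    · rintro ⟨-, i, j, h⟩
      refine ⟨i, ⟨j % k, Nat.mod_lt _ hk⟩, ?_⟩
      have : ∀ a, c i (j % k * n + a) = c i (j * n + a) := fun a =>
        (hc.eq_iff _ _ _).2 (((Nat.mod_modEq j k).mul_right' n).add_right a)
      simp only [this]
      exact h
    · rintro ⟨i, j, h⟩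
      refine ⟨?_, i, j, h⟩
      rw [← SimpleGraph.mem_edgeSet, h, show (j : ℕ) * n + n = j * n + (n - 1) + 1 by omega]
      exact hc.adj _ _

end SegmentedCycles

theorem decomposition_of_segmentedCycles {n k r : ℕ} {ι : Type} [Fintype ι]
    {c : ι → ℕ → Fin n → Bool} (hc : SegmentedCycles k c) (hn : 2 ≤ n) (hk : 1 ≤ k)
    (hkn : 3 ≤ k * n) (hr : r * k = 2 ^ (n - 1)) (hcard : Fintype.card ι = r) :
    ∃ (C : Fin r → (cube n).Subgraph) (e : Fin r → Fin k → Sym2 (Fin n → Bool)),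
      IsDecomposition C ∧
      (∀ i, IsCycleOfLength (C i).coe (k * n)) ∧
      (∀ i, Function.Injective (e i) ∧
        (∀ j, e i j ∈ (C i).edgeSet) ∧
        Nat.card ((C i).deleteEdges (Set.range (e i))).coe.ConnectedComponent = k ∧
        ∀ c : ((C i).deleteEdges (Set.range (e i))).coe.ConnectedComponent,
          IsPathOfLength c.toSimpleGraph (n - 1)) ∧
      ∃ M : (cube n).Subgraph,
        M.edgeSet = {f | ∃ i j, f = e i j} ∧ M.IsPerfectMatching := by
  have hcard' : Fintype.card ι * k = 2 ^ (n - 1) := by rw [hcard, hr]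
  let ψ : Fin r ≃ ι := (Fintype.equivFinOfCardEq hcard).symm
  have hsucc : ∀ j : ℕ, j * n + n = j * n + (n - 1) + 1 := fun j => by omega
  refine ⟨fun i => traceSubgraph (c (ψ i)) (hc.adj (ψ i)),
    fun i j => s(c (ψ i) (j * n + (n - 1)), c (ψ i) (j * n + n)), ?_, ?_, ?_, SegmentedCycles.matching c, ?_,
    hc.isPerfectMatching_matching hn hk hcard'⟩
  · intro f hf
    induction f with
    | _ x y =>
      obtain ⟨i, t, h⟩ := hc.edge x y hf
      refine ⟨ψ.symm i, ?_, ?_⟩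
      · simp only [mem_edgeSet_traceSubgraph]
        exact ⟨t, by simpa using h⟩
      · intro i' hi'
        simp only [mem_edgeSet_traceSubgraph] at hi'
        obtain ⟨t', h'⟩ := hi'
        rw [Equiv.eq_symm_apply]
        exact (hc.edge_unique hn hk hcard' (h'.symm.trans h)).1
  · exact fun i => isCycleOfLength_traceSubgraph _ _ hkn (hc.eq_iff (ψ i))
  · intro i
    refine ⟨?_, ?_, hc.deleteEdges_components hn hk hkn (ψ i)⟩
    · intro j j' h
      simp only [hsucc] at h
      have h1 := (hc.edge_unique hn hk hcard' h).2
      have h2 := Nat.ModEq.mul_right_cancel' (by omega) (Nat.ModEq.add_right_cancel' _ h1)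
      exact Fin.ext (Nat.ModEq.eq_of_lt_of_lt h2 j.2 j'.2)
    · intro j
      rw [mem_edgeSet_traceSubgraph]
      exact ⟨j * n + (n - 1), by simp only [hsucc]⟩
  · ext f
    rw [hc.mem_edgeSet_matching hn hk]
    constructor
    · rintro ⟨i, j, h⟩
      exact ⟨ψ.symm i, j, by simpa using h⟩
    · rintro ⟨i, j, h⟩
      exact ⟨ψ i, j, h⟩

/-! ### Parity -/

theorem parity_xor {n : ℕ} (x y : Fin n → Bool) :
    parity (fun i => x i ^^ y i) = parity x + parity y := by
  simp only [parity, ← Finset.sum_add_distrib]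
  refine Finset.sum_congr rfl fun i _ => ?_
  have h : ∀ a b : Bool, (if a ^^ b then 1 else 0 : ZMod 2) =
      (if a then 1 else 0) + if b then 1 else 0 := by decide
  exact h _ _

theorem parity_flipAt {n : ℕ} (d : Fin n) (x : Fin n → Bool) :
    parity (flipAt d x) = parity x + 1 := by
  have h : flipAt d x = fun i => x i ^^ decide (i = d) := by
    funext i
    by_cases hi : i = d
    · subst hi; simp [flipAt]
    · simp [flipAt, hi]
  rw [h, parity_xor]
  simp [parity]

theorem parity_val_lt {n r : ℕ} (hr : r ≤ n) :
    parity (fun i : Fin n => decide ((i : ℕ) < r)) = r := by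
  induction r with
  | zero => simp [parity]
  | succ r ih =>
    have h : (fun i : Fin n => decide ((i : ℕ) < r + 1)) =
        flipAt ⟨r, hr⟩ (fun i : Fin n => decide ((i : ℕ) < r)) := by
      funext i
      by_cases hi : i = ⟨r, hr⟩
      · subst hi; simp [flipAt]
      · have : (i : ℕ) ≠ r := fun h => hi (Fin.ext h)
        simp only [flipAt, Function.update_of_ne hi]
        exact decide_eq_decide.2 (by omega)
    rw [h, parity_flipAt, ih (by omega)]
    push_cast
    rfl

/-- This is how evenness of the dimension enters the base case: both segment starts on a sweep
cycle, being complementary, have equal parity. -/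
theorem parity_not {n : ℕ} (hn : Even n) (x : Fin n → Bool) :
    parity (fun i => !x i) = parity x := by
  have h : (fun i => !x i) = fun i => x i ^^ decide ((i : ℕ) < n) := by
    funext i; simp
  rw [h, parity_xor, parity_val_lt le_rfl, (ZMod.natCast_eq_zero_iff_even).2 hn, add_zero]

/-! ### Cycles of length `2 * n` -/

/-- `v` with all entries changed if `q` is odd, and then the first `r` entries changed. -/
def sweep {n : ℕ} (v : Fin n → Bool) (q r : ℕ) : Fin n → Bool :=
  fun i => v i ^^ decide (q % 2 = 1) ^^ decide ((i : ℕ) < r)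

theorem sweep_succ_right {n : ℕ} (v : Fin n → Bool) (q : ℕ) {r : ℕ} (hr : r < n) :
    sweep v q (r + 1) = flipAt ⟨r, hr⟩ (sweep v q r) := by
  funext i
  by_cases hi : i = ⟨r, hr⟩
  · subst hi; simp [flipAt, sweep]
  · have h : (i : ℕ) ≠ r := fun h => hi (Fin.ext h)
    simp only [flipAt, Function.update_of_ne hi, sweep]
    congr 1
    exact decide_eq_decide.2 (by omega)

theorem sweep_succ_left {n : ℕ} (v : Fin n → Bool) (q : ℕ) : sweep v (q + 1) 0 = sweep v q n := by
  funext i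
  rcases Nat.mod_two_eq_zero_or_one q with h | h <;>
    simp [sweep, Nat.add_mod, h]

/-- The closed walk that changes the entries of `v` in cyclic order. -/
def sweepCycle {n : ℕ} (v : Fin n → Bool) (t : ℕ) : Fin n → Bool := sweep v (t / n) (t % n)

theorem sweepCycle_mul_add {n : ℕ} (v : Fin n → Bool) (q : ℕ) {r : ℕ} (hr : r < n) :
    sweepCycle v (q * n + r) = sweep v q r := by
  rw [sweepCycle, mul_comm, Nat.mul_add_div (by omega), Nat.mul_add_mod, Nat.mod_eq_of_lt hr,
    Nat.div_eq_of_lt hr, add_zero]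

theorem sweepCycle_mul_add_succ {n : ℕ} (v : Fin n → Bool) (q : ℕ) {r : ℕ} (hr : r < n) :
    sweepCycle v (q * n + r + 1) = flipAt ⟨r, hr⟩ (sweep v q r) := by
  rw [← sweep_succ_right]
  by_cases h : r + 1 < n
  · rw [add_assoc, sweepCycle_mul_add v q h]
  · have h : r + 1 = n := by omega
    have h' := sweepCycle_mul_add v (q + 1) (show 0 < n by omega)
    rw [add_assoc, h, ← sweep_succ_left, ← h', add_mul, one_mul, add_zero]

/-- The even tuple with last entry `false` and middle entries `y`. -/
def evenLift {l : ℕ} (y : Fin l → Bool) : Fin (l + 2) → Bool :=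
  Fin.snoc (α := fun _ => Bool) (Fin.cons (α := fun _ => Bool) (decide (parity y = 1)) y) false

theorem exists_evenLift_eq {l : ℕ} (x : Fin (l + 2) → Bool) (hx : parity x = 0)
    (hlast : x (Fin.last _) = false) : ∃ y, x = evenLift y := by
  obtain ⟨z, b, rfl⟩ : ∃ z b, x = Fin.snoc (α := fun _ => Bool) z b :=
    ⟨_, _, (Fin.snoc_init_self x).symm⟩
  obtain ⟨a, y, rfl⟩ : ∃ a y, z = Fin.cons (α := fun _ => Bool) a y :=
    ⟨_, _, (Fin.cons_self_tail z).symm⟩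
  refine ⟨y, ?_⟩
  simp only [Fin.snoc_last] at hlast
  subst hlast
  have h : (if a then 1 else 0) + parity y = 0 := by
    simpa [parity, Fin.sum_univ_castSucc (n := l + 1), Fin.sum_univ_succ (n := l)] using hx
  rw [evenLift]
  congr 2
  rcases parity_eq_zero_or_one y with h' | h' <;> cases a <;> simp_all

/-- Of `w` and its complement exactly one ends in `false`, and that one represents the cycle; `p`
records which of the two `w` is. -/
theorem exists_sweep_eq {l : ℕ} (hl : Even l) (w : Fin (l + 2) → Bool) (hw : parity w = 0) :
    ∃ y p, ∀ q r, sweep w q r = sweep (evenLift y) (q + p) r := by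
  cases hlast : w (Fin.last _)
  · obtain ⟨y, hy⟩ := exists_evenLift_eq w hw hlast
    exact ⟨y, 0, fun q r => by rw [hy, add_zero]⟩
  · obtain ⟨y, hy⟩ := exists_evenLift_eq (fun i => !w i)
      (by rw [parity_not (by simpa [Nat.even_add_one] using hl), hw]) (by simp [hlast])
    refine ⟨y, 1, fun q r => ?_⟩
    funext i
    have h : w i = !evenLift y i := by rw [← hy]; simp
    rcases Nat.mod_two_eq_zero_or_one q with h' | h' <;>
      simp [sweep, Nat.add_mod, h', h]

theorem segmentedCycles_sweepCycle {l : ℕ} (hl : Even l) :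
    SegmentedCycles 2 fun y : Fin l → Bool => sweepCycle (evenLift y) := by
  have hdecomp : ∀ t : ℕ, ∃ q r, r < l + 2 ∧ t = q * (l + 2) + r := fun t =>
    ⟨t / (l + 2), t % (l + 2), Nat.mod_lt _ (by omega), (Nat.div_add_mod' _ _).symm⟩
  constructor
  · intro y t
    obtain ⟨q, r, hr, rfl⟩ := hdecomp t
    rw [sweepCycle_mul_add_succ _ _ hr, sweepCycle_mul_add _ _ hr]
    exact cube_adj_iff.2 ⟨_, rfl⟩
  · intro y t t'
    obtain ⟨q, r, hr, rfl⟩ := hdecomp t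
    obtain ⟨q', r', hr', rfl⟩ := hdecomp t'
    rw [sweepCycle_mul_add _ _ hr, sweepCycle_mul_add _ _ hr']
    -- A partial sweep never reaches the last entry, which therefore reveals the parity of `q`.
    have hq : ∀ {q r q' r' : ℕ}, sweep (evenLift y) q r = sweep (evenLift y) q' r' → r < l + 2 →
        r' < l + 2 → (q % 2 = 1 ↔ q' % 2 = 1) := by
      intro q r q' r' h hr hr'
      have := congrFun h (Fin.last _)
      simpa [sweep, show ¬ l + 1 < r by omega, show ¬ l + 1 < r' by omega] using this
    constructor
    · intro h
      have h1 : q ≡ q' [MOD 2] := by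
        have := hq h hr hr'
        unfold Nat.ModEq
        omega
      have h2 : ∀ i : Fin (l + 2), (i : ℕ) < r ↔ (i : ℕ) < r' := by
        intro i
        have := congrFun h i
        simpa [sweep, hq h hr hr'] using this
      have h3 : r = r' := by
        have h4 := h2 ⟨r, hr⟩
        have h5 := h2 ⟨r', hr'⟩
        simp only at h4 h5
        omega
      rw [h3]
      exact (h1.mul_right' _).add_right _
    · intro h
      have h1 : r = r' := by
        have := h.of_mul_left 2
        simpa [Nat.ModEq, Nat.mod_eq_of_lt hr, Nat.mod_eq_of_lt hr'] using this
      subst h1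
      have h2 := Nat.ModEq.mul_right_cancel' (by omega) (Nat.ModEq.add_right_cancel' _ h)
      funext i
      rw [sweep, sweep, show q % 2 = q' % 2 from h2]
  · rintro x _ hadj
    obtain ⟨d, rfl⟩ := cube_adj_iff.1 hadj
    have key : ∀ x : Fin (l + 2) → Bool, parity x = d → ∃ (y : Fin l → Bool) (t : ℕ),
        s(x, flipAt d x) = s(sweepCycle (evenLift y) t, sweepCycle (evenLift y) (t + 1)) := by
      intro x hx
      -- Undoing the first `d` flips gives the start of the segment, even because `x` has the parity
      -- of `d`. Exactly one endpoint of each edge in direction `d` has that parity.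
      obtain ⟨y, p, h⟩ := exists_sweep_eq hl (fun i => x i ^^ decide ((i : ℕ) < d))
        (by rw [parity_xor, parity_val_lt d.2.le, hx, CharTwo.add_self_eq_zero])
      refine ⟨y, (0 + p) * (l + 2) + d, ?_⟩
      rw [sweepCycle_mul_add_succ _ _ d.2, sweepCycle_mul_add _ _ d.2, ← h]
      have h' : sweep (fun i => x i ^^ decide ((i : ℕ) < d)) 0 d = x := by
        funext i; simp [sweep]
      rw [h']
    by_cases hx : parity x = d
    · exact key x hx
    · have hx' : parity (flipAt d x) = d := by
        rw [parity_flipAt]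
        generalize parity x = a at hx
        generalize ((d : ℕ) : ZMod 2) = b at hx
        revert a b
        decide
      obtain ⟨y, t, h⟩ := key _ hx'
      refine ⟨y, t, ?_⟩
      have h' : flipAt d (flipAt d x) = x := by simp [flipAt]
      rw [h', Sym2.eq_swap] at h
      exact h
  · intro x hx
    obtain ⟨y, p, h⟩ := exists_sweep_eq hl x hx
    refine ⟨y, 0 + p, ?_⟩
    rw [← add_zero ((0 + p) * (l + 2)), sweepCycle_mul_add _ _ (by omega), ← h]
    funext i; simp [sweep]
  · intro x hx
    obtain ⟨y, p, h⟩ := exists_sweep_eq hl (fun i => x i ^^ decide ((i : ℕ) < l + 1))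
      (by
        rw [parity_xor, parity_val_lt (by omega), hx]
        push_cast
        rw [(ZMod.natCast_eq_zero_iff_even).2 hl]
        decide)
    refine ⟨y, 0 + p, ?_⟩
    rw [show l + 2 - 1 = l + 1 by omega, sweepCycle_mul_add _ _ (by omega), ← h]
    funext i; simp [sweep]

/-! ### Two Hamiltonian cycles of the `4`-cube -/

/-- A decomposition of the `4`-cube into two Hamiltonian cycles, vertices written as numbers. -/
def hamiltonianTable : Bool → Fin 16 → ℕ
  | false => ![0, 1, 3, 2, 6, 7, 5, 13, 9, 8, 10, 11, 15, 14, 12, 4]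
  | true => ![10, 2, 0, 8, 12, 13, 15, 7, 3, 11, 9, 1, 5, 4, 6, 14]

/-- The vertices of two edge-disjoint Hamiltonian cycles of the `4`-cube. -/
def hamiltonian (i : Bool) (t : ZMod 16) : Fin 4 → Bool :=
  fun j => (hamiltonianTable i t).testBit j

set_option maxRecDepth 10000 in
theorem hamiltonian_adj (i : Bool) (t : ZMod 16) :
    (cube 4).Adj (hamiltonian i t) (hamiltonian i (t + 1)) := by
  rw [cube_adj_iff]
  revert i t
  unfold flipAt
  decide

set_option maxRecDepth 10000 in
theorem hamiltonian_injective (i : Bool) : Function.Injective (hamiltonian i) := by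
  intro t t' h
  revert i t t'
  decide

set_option maxRecDepth 10000 in
theorem hamiltonian_edge {x y : Fin 4 → Bool} (h : (cube 4).Adj x y) :
    ∃ i t, s(x, y) = s(hamiltonian i t, hamiltonian i (t + 1)) := by
  obtain ⟨d, rfl⟩ := cube_adj_iff.1 h
  clear h
  simp only [Sym2.eq_iff]
  revert x d
  unfold flipAt
  decide

set_option maxRecDepth 10000 in
theorem hamiltonian_even {x : Fin 4 → Bool} (h : parity x = 0) :
    ∃ i, ∃ q : ZMod 16, x = hamiltonian i (4 * q) := by
  revert x
  unfold parity
  decide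

set_option maxRecDepth 10000 in
theorem hamiltonian_odd {x : Fin 4 → Bool} (h : parity x = 1) :
    ∃ i, ∃ q : ZMod 16, x = hamiltonian i (4 * q + 3) := by
  revert x
  unfold parity
  decide

theorem segmentedCycles_hamiltonian :
    SegmentedCycles 4 fun i (t : ℕ) => hamiltonian i (t : ZMod 16) where
  adj i t := by
    push_cast
    exact hamiltonian_adj _ _
  eq_iff i t t' := by
    rw [(hamiltonian_injective i).eq_iff]
    exact ZMod.natCast_eq_natCast_iff _ _ _
  edge x y h := by
    obtain ⟨i, t, h⟩ := hamiltonian_edge h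
    obtain ⟨t, rfl⟩ := ZMod.natCast_zmod_surjective t
    exact ⟨i, t, by push_cast; exact h⟩
  even x h := by
    obtain ⟨i, q, h⟩ := hamiltonian_even h
    obtain ⟨q, rfl⟩ := ZMod.natCast_zmod_surjective q
    exact ⟨i, q, by push_cast; rwa [mul_comm]⟩
  odd x h := by
    obtain ⟨i, q, h⟩ := hamiltonian_odd h
    obtain ⟨q, rfl⟩ := ZMod.natCast_zmod_surjective q
    exact ⟨i, q, by push_cast; rwa [mul_comm]⟩

/-! ### The product with the `4`-cube -/

theorem parity_append {m n : ℕ} (x : Fin m → Bool) (w : Fin n → Bool) :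
    parity (Fin.append x w) = parity x + parity w := by
  simp only [parity, Fin.sum_univ_add, Fin.append_left, Fin.append_right]

theorem flipAt_castAdd_append {m n : ℕ} (d : Fin m) (x : Fin m → Bool) (w : Fin n → Bool) :
    flipAt (Fin.castAdd n d) (Fin.append x w) = Fin.append (flipAt d x) w := by
  funext j
  induction j using Fin.addCases with
  | left j =>
    by_cases h : j = d
    · subst h; simp [flipAt]
    · simp [flipAt, h]
  | right j =>
    have h : Fin.natAdd m j ≠ Fin.castAdd n d := by simp [Fin.ext_iff]; omega
    simp [flipAt, h]

theorem flipAt_natAdd_append {m n : ℕ} (d : Fin n) (x : Fin m → Bool) (w : Fin n → Bool) :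
    flipAt (Fin.natAdd m d) (Fin.append x w) = Fin.append x (flipAt d w) := by
  funext j
  induction j using Fin.addCases with
  | left j =>
    have h : Fin.castAdd n j ≠ Fin.natAdd m d := by simp [Fin.ext_iff]; omega
    simp [flipAt, h]
  | right j =>
    by_cases h : j = d
    · subst h; simp [flipAt]
    · simp [flipAt, h]

theorem exists_append_eq {m n : ℕ} (z : Fin (m + n) → Bool) :
    ∃ x w, z = Fin.append x w :=
  ⟨fun i => z (Fin.castAdd n i), fun i => z (Fin.natAdd m i), (Fin.append_castAdd_natAdd).symm⟩

theorem append_eq_append_iff {m n : ℕ} {x x' : Fin m → Bool} {w w' : Fin n → Bool} :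
    Fin.append x w = Fin.append x' w' ↔ x = x' ∧ w = w' := by
  constructor
  · intro h
    constructor
    · funext j
      simpa using congrFun h (Fin.castAdd n j)
    · funext j
      simpa using congrFun h (Fin.natAdd m j)
  · rintro ⟨rfl, rfl⟩
    rfl

theorem flipAt_flipAt {n : ℕ} (d : Fin n) (x : Fin n → Bool) : flipAt d (flipAt d x) = x := by
  simp [flipAt]

theorem flipAt_comm {n : ℕ} (d d' : Fin n) (x : Fin n → Bool) :
    flipAt d (flipAt d' x) = flipAt d' (flipAt d x) := by
  by_cases h : d = d'
  · rw [h]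
  · simp [flipAt, Function.update_of_ne h, Function.update_of_ne (Ne.symm h),
      Function.update_comm h]

/-- Change the entry `d` of `x` if `δ` holds. -/
def flipIf {n : ℕ} (δ : Bool) (d : Fin n) (x : Fin n → Bool) : Fin n → Bool :=
  if δ then flipAt d x else x

theorem flipIf_flipIf {n : ℕ} (δ : Bool) (d : Fin n) (x : Fin n → Bool) :
    flipIf δ d (flipIf δ d x) = x := by
  cases δ <;> simp [flipIf, flipAt_flipAt]

theorem flipIf_injective {n : ℕ} (δ : Bool) (d : Fin n) : Function.Injective (flipIf δ d) :=
  Function.LeftInverse.injective (flipIf_flipIf δ d)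

theorem cube_adj_flipIf {n : ℕ} (δ : Bool) (d : Fin n) {x y : Fin n → Bool}
    (h : (cube n).Adj x y) : (cube n).Adj (flipIf δ d x) (flipIf δ d y) := by
  obtain ⟨d', rfl⟩ := cube_adj_iff.1 h
  refine cube_adj_iff.2 ⟨d', ?_⟩
  cases δ <;> simp [flipIf, flipAt_comm d d']

theorem parity_flipIf {n : ℕ} (δ : Bool) (d : Fin n) (x : Fin n → Bool) :
    parity (flipIf δ d x) = parity x + if δ then 1 else 0 := by
  cases δ <;> simp [flipIf, parity_flipAt]

/-- The even vertices of a product are the pairs even-even and odd-odd. Flipping one coordinate in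
each factor exchanges these types, so `δ` reduces every covering question to a factor with an even
vertex. -/
theorem exists_parity_flipIf_eq_zero {n : ℕ} (d : Fin n) (x : Fin n → Bool) :
    ∃ δ, parity (flipIf δ d x) = 0 := by
  rcases parity_eq_zero_or_one x with h | h
  · exact ⟨false, by rw [parity_flipIf, h]; rfl⟩
  · exact ⟨true, by rw [parity_flipIf, h]; decide⟩

/-- The position on a cycle of length `16` after `T` steps of length `4`; the steps are forward,
except that for `k ≠ 2` each step number congruent to `-1` modulo `k` is backward. -/
def level (k T : ℕ) : ZMod 16 := 4 * T + if k = 2 then 0 else 8 * ((T / k : ℕ) : ZMod 16)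

/-- The direction of step number `T`, see `level`. -/
def dir (k T : ℕ) : ZMod 16 := if k ≠ 2 ∧ k ∣ T + 1 then -1 else 1

theorem dir_eq (k T : ℕ) : dir k T = 1 ∨ dir k T = -1 := by
  unfold dir
  split_ifs <;> simp

theorem dir_congr {k T T' : ℕ} (h : T ≡ T' [MOD k]) : dir k T = dir k T' := by
  have : k ∣ T + 1 ↔ k ∣ T' + 1 := (h.add_right 1).dvd_iff dvd_rfl
  simp only [dir, this]

theorem level_succ (k T : ℕ) : level k (T + 1) = level k T + 4 * dir k T := by
  by_cases hk : k = 2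
  · simp [level, dir, hk]; ring
  · by_cases hd : k ∣ T + 1
    · simp only [level, dir, hk, hd, Nat.succ_div, if_true, if_false, ne_eq, not_false_eq_true,
        and_self]
      push_cast
      ring_nf
      -- At a multiple of `k` the quotient term adds `8` to the usual `4`, which is a step of `-4`
      -- modulo `16`.
      rw [show (12 : ZMod 16) = -4 by decide]
    · simp only [level, dir, hk, hd, Nat.succ_div, if_false, and_false]
      push_cast
      ring

/-- For `k = 2` the shift is `4 * 2`. For `4 ∣ k` the term `4 * k` vanishes modulo `16`, and the one
backward step leaves `-8 = 8`. -/
theorem level_add_self {k : ℕ} (hk : k = 2 ∨ 4 ∣ k) (hk0 : 0 < k) (T : ℕ) :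
    level k (T + k) = level k T + 8 := by
  by_cases h2 : k = 2
  · subst h2; simp [level]; ring_nf
  · obtain ⟨l, rfl⟩ := hk.resolve_left h2
    simp only [level, h2, if_false, Nat.add_div_right _ hk0]
    push_cast
    have : (16 : ZMod 16) = 0 := by decide
    linear_combination (l : ZMod 16) * this

theorem level_congr {k : ℕ} (hk : k = 2 ∨ 4 ∣ k) (hk0 : 0 < k) {T T' : ℕ}
    (h : T ≡ T' [MOD 2 * k]) : level k T = level k T' := by
  have hper : ∀ T s : ℕ, level k (T + 2 * k * s) = level k T := by
    intro T s
    induction s with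
    | zero => simp
    | succ s ih =>
      rw [show T + 2 * k * (s + 1) = T + 2 * k * s + k + k by ring, level_add_self hk hk0,
        level_add_self hk hk0, ih, add_assoc, show (8 + 8 : ZMod 16) = 0 by decide, add_zero]
  rw [← Nat.mod_add_div T (2 * k), ← Nat.mod_add_div T' (2 * k), hper, hper,
    show T % (2 * k) = T' % (2 * k) from h]

/-- Levels are multiples of `4`. The offset `ε` contributes `4` and replacing `p` by `p + k`
contributes `8`, so together they reach all four such residues modulo `16`. -/
theorem exists_level_eq {k : ℕ} (hk : k = 2 ∨ 4 ∣ k) (hk0 : 0 < k) (p : ℕ) (q : ZMod 16) :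
    ∃ (ε : Bool) (T : ℕ), T ≡ p [MOD k] ∧ (if ε then 4 else 0) + level k T = 4 * q := by
  obtain ⟨s, hs⟩ : ∃ s, level k p = 4 * s := by
    unfold level
    split_ifs
    · exact ⟨p, by ring⟩
    · exact ⟨p + 2 * ((p / k : ℕ) : ZMod 16), by ring⟩
  have h : ∀ q s : ZMod 16, ∃ ε h : Bool,
      (if ε then 4 else 0) + (4 * s + if h then 8 else 0) = 4 * q := by decide
  obtain ⟨ε, b, h⟩ := h q s
  cases b
  · exact ⟨ε, p, rfl, by simpa [hs] using h⟩
  · exact ⟨ε, p + k, by simp [Nat.ModEq], by simpa [level_add_self hk hk0, hs] using h⟩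

namespace SegmentedCycles

variable {n k : ℕ} {ι : Type}

/-- The vertices of the product cycles: the block number `T` consists of `4` steps along one of the
Hamiltonian cycles of the `4`-cube, followed by `n` steps along a given cycle of the `n`-cube. -/
def prodVertex (k : ℕ) (c : ι → ℕ → Fin n → Bool) (d : Fin n) (s : Bool × Bool × Bool × ι)
    (T a : ℕ) : Fin (4 + n) → Bool :=
  Fin.append
    (flipIf s.1 0 (hamiltonian s.2.1
      ((if s.2.2.1 then 4 else 0) + level k T + dir k T * (min a 4 : ℕ))))
    (flipIf s.1 d (c s.2.2.2 (T * n + (a - 4))))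

/-- The product cycles as closed sequences. -/
def prodCycle (k : ℕ) (c : ι → ℕ → Fin n → Bool) (d : Fin n) (s : Bool × Bool × Bool × ι) (t : ℕ) :
    Fin (4 + n) → Bool :=
  prodVertex k c d s (t / (4 + n)) (t % (4 + n))

variable (c : ι → ℕ → Fin n → Bool) (d : Fin n)

theorem prodVertex_of_le (s : Bool × Bool × Bool × ι) (T : ℕ) {a : ℕ} (ha : a ≤ 4) :
    prodVertex k c d s T a = Fin.append
      (flipIf s.1 0 (hamiltonian s.2.1 ((if s.2.2.1 then 4 else 0) + level k T + dir k T * a)))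
      (flipIf s.1 d (c s.2.2.2 (T * n))) := by
  rw [prodVertex, min_eq_left ha, Nat.sub_eq_zero_of_le ha, add_zero]

theorem prodVertex_four_add (s : Bool × Bool × Bool × ι) (T r : ℕ) :
    prodVertex k c d s T (4 + r) = Fin.append
      (flipIf s.1 0 (hamiltonian s.2.1 ((if s.2.2.1 then 4 else 0) + level k (T + 1))))
      (flipIf s.1 d (c s.2.2.2 (T * n + r))) := by
  rw [prodVertex, min_eq_right (by omega), Nat.add_sub_cancel_left, level_succ]
  push_cast
  rw [add_assoc, mul_comm (dir k T) 4]

theorem prodCycle_mul_add (s : Bool × Bool × Bool × ι) (T : ℕ) {a : ℕ} (ha : a < 4 + n) :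
    prodCycle k c d s (T * (4 + n) + a) = prodVertex k c d s T a := by
  rw [prodCycle, mul_comm, Nat.mul_add_div (by omega), Nat.mul_add_mod, Nat.mod_eq_of_lt ha,
    Nat.div_eq_of_lt ha, add_zero]

/-- The point at issue is the seam between blocks: the formula for a block, continued to `a = 4 +
n`, gives the start of the next one. -/
theorem prodCycle_mul_add_succ (s : Bool × Bool × Bool × ι) (T : ℕ) {a : ℕ} (ha : a < 4 + n) :
    prodCycle k c d s (T * (4 + n) + a + 1) = prodVertex k c d s T (a + 1) := by
  by_cases h : a + 1 < 4 + n
  · rw [add_assoc, prodCycle_mul_add c d s T h]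
  · have h : a + 1 = 4 + n := by omega
    have h' := prodCycle_mul_add (k := k) c d s (T + 1) (show 0 < 4 + n by omega)
    rw [add_assoc, h, prodVertex_four_add, ← add_zero (T * (4 + n) + (4 + n)), ← Nat.succ_mul, h',
      prodVertex_of_le c d s _ (by omega), Nat.succ_mul]
    simp

variable {c}

/-- From cycles of length `k * n` in the `n`-cube to cycles of length `2 * k * (4 + n)` in the
`(4 + n)`-cube. -/
theorem prod (hc : SegmentedCycles k c) (hk : k = 2 ∨ 4 ∣ k) (hk0 : 0 < k) :
    SegmentedCycles (2 * k) (prodCycle k c d) := by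
  have hn : 0 < n := d.pos
  have hdecomp : ∀ t : ℕ, ∃ T a, a < 4 + n ∧ t = T * (4 + n) + a := fun t =>
    ⟨t / (4 + n), t % (4 + n), Nat.mod_lt _ (by omega), (Nat.div_add_mod' _ _).symm⟩
  have hper : ∀ i T T' r, T ≡ T' [MOD k] → c i (T * n + r) = c i (T' * n + r) := fun i T T' r h =>
    (hc.eq_iff _ _ _).2 ((h.mul_right' n).add_right r)
  constructor
  · intro s t
    obtain ⟨T, a, ha, rfl⟩ := hdecomp t
    rw [prodCycle_mul_add_succ c d s T ha, prodCycle_mul_add c d s T ha]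
    rcases Nat.lt_or_ge a 4 with h4 | h4
    · rw [prodVertex_of_le c d s T h4, prodVertex_of_le c d s T h4.le]
      have hadj : ∀ p : ZMod 16, (cube 4).Adj
          (flipIf s.1 0 (hamiltonian s.2.1 (p + dir k T * a)))
          (flipIf s.1 0 (hamiltonian s.2.1 (p + dir k T * (a + 1 : ℕ)))) := by
        intro p
        refine cube_adj_flipIf _ _ ?_
        push_cast
        rcases dir_eq k T with h | h <;> rw [h]
        · have := hamiltonian_adj s.2.1 (p + 1 * a)
          rwa [show p + 1 * (a : ZMod 16) + 1 = p + 1 * (a + 1) by ring] at this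
        · have := hamiltonian_adj s.2.1 (p + -1 * (a + 1))
          rw [show p + -1 * ((a : ZMod 16) + 1) + 1 = p + -1 * a by ring] at this
          exact this.symm
      obtain ⟨e, he⟩ := cube_adj_iff.1 (hadj ((if s.2.2.1 then 4 else 0) + level k T))
      rw [he, ← flipAt_castAdd_append]
      exact cube_adj_iff.2 ⟨_, rfl⟩
    · obtain ⟨r, rfl⟩ := Nat.exists_eq_add_of_le h4
      rw [add_assoc, prodVertex_four_add, prodVertex_four_add]
      obtain ⟨e, he⟩ := cube_adj_iff.1
        (cube_adj_flipIf s.1 d (hc.adj s.2.2.2 (T * n + r)))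
      rw [← add_assoc, he, ← flipAt_natAdd_append]
      exact cube_adj_iff.2 ⟨_, rfl⟩
  · intro s t t'
    obtain ⟨T, a, ha, rfl⟩ := hdecomp t
    obtain ⟨T', a', ha', rfl⟩ := hdecomp t'
    rw [prodCycle_mul_add c d s T ha, prodCycle_mul_add c d s T' ha']
    constructor
    · intro h
      rw [prodVertex, prodVertex, append_eq_append_iff, (flipIf_injective _ _).eq_iff,
        (flipIf_injective _ _).eq_iff, (hamiltonian_injective _).eq_iff, hc.eq_iff] at h
      obtain ⟨h1, h2⟩ := h
      have h3 : a - 4 = a' - 4 := by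
        have := h2.of_mul_left k
        simpa [Nat.ModEq, Nat.mod_eq_of_lt (show a - 4 < n by omega),
          Nat.mod_eq_of_lt (show a' - 4 < n by omega)] using this
      rw [h3] at h2
      have h4 : T ≡ T' [MOD k] := Nat.ModEq.mul_right_cancel' (by omega)
        (Nat.ModEq.add_right_cancel' _ h2)
      -- Two quarters run in the same direction from antipodal levels never meet, as each moves at
      -- most `4` of the `8` steps between them.
      have hmin : ∀ D : ZMod 16, D = 1 ∨ D = -1 → ∀ m m' : ℕ, m ≤ 4 → m' ≤ 4 →
          (D * m = D * m' → m = m') ∧ (8 + D * m ≠ D * m') := by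
        have : ∀ D : ZMod 16, D = 1 ∨ D = -1 → ∀ m m' : Fin 5,
            (D * (m : ℕ) = D * (m' : ℕ) → m = m') ∧ (8 + D * (m : ℕ) ≠ D * (m' : ℕ)) := by
          decide
        intro D hD m m' hm hm'
        have h := this D hD ⟨m, by omega⟩ ⟨m', by omega⟩
        exact ⟨fun h' => Fin.mk.inj_iff.1 (h.1 h'), h.2⟩
      have hmin := hmin (dir k T') (dir_eq k T') (min a 4) (min a' 4) (by omega) (by omega)
      rw [dir_congr h4] at h1
      -- The second factor determines the block only modulo `k`; the first factor must rule out a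
      -- difference of `k`.
      have h5 : T ≡ T' [MOD 2 * k] ∨ T ≡ T' + k [MOD 2 * k] := by
        have e1 := Nat.mod_add_div T k
        have e2 := Nat.mod_add_div T' k
        rw [show T % k = T' % k from h4] at e1
        rcases Nat.even_or_odd (T / k + T' / k) with he | ho
        · left
          have : T / k ≡ T' / k [MOD 2] := by
            unfold Nat.ModEq; rw [Nat.even_add] at he; rw [Nat.even_iff, Nat.even_iff] at he; omega
          rw [← e1, ← e2, mul_comm k, mul_comm k]
          simpa using (this.mul_right' k).add_left (T' % k)
        · right
          have : T / k ≡ T' / k + 1 [MOD 2] := by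
            unfold Nat.ModEq; rw [Nat.odd_iff] at ho; omega
          have := (this.mul_right' k).add_left (T' % k)
          rw [mul_comm (T / k), e1, add_mul, one_mul, ← add_assoc, mul_comm (T' / k), e2] at this
          exact this
      rcases h5 with h5 | h5
      · rw [level_congr hk hk0 h5, add_right_inj] at h1
        have h6 : a = a' := by
          have := hmin.1 h1
          omega
        rw [h6]
        exact (h5.mul_right' _).add_right _
      · exfalso
        rw [level_congr hk hk0 h5, level_add_self hk hk0] at h1
        exact hmin.2 (by linear_combination h1)
    · intro h
      have h1 : a = a' := by
        have := h.of_mul_left (2 * k)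
        simpa [Nat.ModEq, Nat.mod_eq_of_lt ha, Nat.mod_eq_of_lt ha'] using this
      subst h1
      have h2 : T ≡ T' [MOD 2 * k] := Nat.ModEq.mul_right_cancel' (by omega)
        (Nat.ModEq.add_right_cancel' _ h)
      have h3 : T ≡ T' [MOD k] := h2.of_mul_left 2
      rw [prodVertex, prodVertex, level_congr hk hk0 h2, dir_congr h3, hper _ _ _ _ h3]
  · intro z z' hz
    obtain ⟨e, rfl⟩ := cube_adj_iff.1 hz
    obtain ⟨x, w, rfl⟩ := exists_append_eq z
    induction e using Fin.addCases with
    | left e =>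
      rw [flipAt_castAdd_append]
      -- An edge in the `4`-cube direction is traversed while the second coordinate rests at a
      -- segment start, so `w` is made even.
      obtain ⟨δ, hδ⟩ := exists_parity_flipIf_eq_zero d w
      obtain ⟨b, p, hp⟩ := hc.even _ hδ
      obtain ⟨i, u, hu⟩ := hamiltonian_edge
        (cube_adj_flipIf δ 0 (cube_adj_iff.2 ⟨e, rfl⟩ : (cube 4).Adj x (flipAt e x)))
      have hw : w = flipIf δ d (c b (p * n)) := by rw [← hp, flipIf_flipIf]
      have hsym := congrArg (Sym2.map fun X => Fin.append (flipIf δ 0 X) w) hu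
      simp only [Sym2.map_mk, flipIf_flipIf] at hsym
      obtain ⟨q, r, hr⟩ : ∃ q : ZMod 16, ∃ r : Fin 4, u = 4 * q + (r : ℕ) := by
        clear hu hsym
        revert u
        decide
      rcases dir_eq k p with hdir | hdir
      · obtain ⟨ε, T, hT, hlev⟩ := exists_level_eq hk hk0 p q
        refine ⟨(δ, i, ε, b), T * (4 + n) + r, ?_⟩
        rw [prodCycle_mul_add_succ c d _ T (by omega), prodCycle_mul_add c d _ T (by omega),
          prodVertex_of_le c d _ T (by omega), prodVertex_of_le c d _ T (by omega), hsym]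
        simp only [dir_congr hT, hdir, hlev]
        have := hper b T p 0 hT
        simp only [add_zero] at this
        rw [this, ← hw, hr]
        push_cast
        simp only [one_mul, add_assoc]
      -- A backward block enters the quarter at its far end `4 * (q + 1)` and crosses the edge at
      -- offset `r` after `3 - r` steps.
      · obtain ⟨ε, T, hT, hlev⟩ := exists_level_eq hk hk0 p (q + 1)
        obtain ⟨r', hr'⟩ : ∃ r', (r : ℕ) + r' = 3 := ⟨3 - r, by omega⟩
        have hcast : (r : ZMod 16) = 3 - r' := by
          rw [eq_sub_iff_add_eq]
          exact_mod_cast congrArg (Nat.cast : ℕ → ZMod 16) hr'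
        refine ⟨(δ, i, ε, b), T * (4 + n) + r', ?_⟩
        rw [prodCycle_mul_add_succ c d _ T (by omega), prodCycle_mul_add c d _ T (by omega),
          prodVertex_of_le c d _ T (by omega), prodVertex_of_le c d _ T (by omega), hsym,
          Sym2.eq_swap]
        simp only [dir_congr hT, hdir, hlev]
        have := hper b T p 0 hT
        simp only [add_zero] at this
        rw [this, ← hw, hr]
        push_cast
        rw [hcast]
        ring_nf
    | right e =>
      rw [flipAt_natAdd_append]
      obtain ⟨δ, hδ⟩ := exists_parity_flipIf_eq_zero 0 x
      obtain ⟨i, q, hq⟩ := hamiltonian_even hδ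
      obtain ⟨b, u, hu⟩ := hc.edge _ _
        (cube_adj_flipIf δ d (cube_adj_iff.2 ⟨e, rfl⟩ : (cube n).Adj w (flipAt e w)))
      have hx : x = flipIf δ 0 (hamiltonian i (4 * q)) := by rw [← hq, flipIf_flipIf]
      have hsym := congrArg (Sym2.map fun W => Fin.append x (flipIf δ d W)) hu
      simp only [Sym2.map_mk, flipIf_flipIf] at hsym
      obtain ⟨p, r, hr, rfl⟩ : ∃ p r, r < n ∧ u = p * n + r :=
        ⟨u / n, u % n, Nat.mod_lt _ hn, (Nat.div_add_mod' _ _).symm⟩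
      -- During the second part of a block the first coordinate rests at the next level; subtracting
      -- the direction makes that level `4 * q`.
      obtain ⟨ε, T, hT, hlev⟩ := exists_level_eq hk hk0 p (q - dir k p)
      have hlev' : (if ε then 4 else 0) + level k (T + 1) = 4 * q := by
        rw [level_succ, dir_congr hT]
        linear_combination hlev
      refine ⟨(δ, i, ε, b), T * (4 + n) + (4 + r), ?_⟩
      rw [prodCycle_mul_add_succ c d _ T (by omega), prodCycle_mul_add c d _ T (by omega),
        add_assoc 4, prodVertex_four_add, prodVertex_four_add, hsym]
      simp only [hlev', ← hx, hper b T p _ hT]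
      rfl
  · intro z hz
    obtain ⟨x, w, rfl⟩ := exists_append_eq z
    obtain ⟨δ, hδ⟩ := exists_parity_flipIf_eq_zero 0 x
    have hw : parity (flipIf δ d w) = 0 := by
      rw [parity_append] at hz
      rw [parity_flipIf] at hδ ⊢
      have h2 : parity x + parity x = 0 := CharTwo.add_self_eq_zero _
      linear_combination hz + hδ - h2
    obtain ⟨i, q, hq⟩ := hamiltonian_even hδ
    obtain ⟨b, p, hp⟩ := hc.even _ hw
    obtain ⟨ε, T, hT, hlev⟩ := exists_level_eq hk hk0 p q
    refine ⟨(δ, i, ε, b), T, ?_⟩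
    have h := prodCycle_mul_add (k := k) c d (δ, i, ε, b) T (show 0 < 4 + n by omega)
    have hper' := hper b T p 0 hT
    rw [add_zero, add_zero] at hper'
    rw [add_zero, prodVertex_of_le c d _ T (by omega)] at h
    simp only [Nat.cast_zero, mul_zero, add_zero, hlev, hper', ← hq, ← hp, flipIf_flipIf] at h
    exact h.symm
  · intro z hz
    obtain ⟨x, w, rfl⟩ := exists_append_eq z
    obtain ⟨δ, hδ⟩ := exists_parity_flipIf_eq_zero 0 x
    have hw : parity (flipIf δ d w) = 1 := by
      rw [parity_append] at hz
      rw [parity_flipIf] at hδ ⊢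
      have h2 : parity x + parity x = 0 := CharTwo.add_self_eq_zero _
      linear_combination hz + hδ - h2
    obtain ⟨i, q, hq⟩ := hamiltonian_even hδ
    obtain ⟨b, p, hp⟩ := hc.odd _ hw
    obtain ⟨ε, T, hT, hlev⟩ := exists_level_eq hk hk0 p (q - dir k p)
    have hlev' : (if ε then 4 else 0) + level k (T + 1) = 4 * q := by
      rw [level_succ, dir_congr hT]
      linear_combination hlev
    refine ⟨(δ, i, ε, b), T, ?_⟩
    rw [show 4 + n - 1 = 4 + (n - 1) by omega, prodCycle_mul_add c d _ T (by omega),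
      prodVertex_four_add]
    simp only [hlev', hper b T p _ hT, ← hq, ← hp, flipIf_flipIf]

end SegmentedCycles

/-! ### Induction on the exponent and conclusion -/

theorem exists_segmentedCycles (m : ℕ) : ∀ n, Even n → 2 ^ (m + 1) ≤ n →
    ∃ (ι : Type) (_ : Fintype ι) (c : ι → ℕ → Fin n → Bool),
      SegmentedCycles (2 ^ (m + 1)) c ∧ Fintype.card ι * 2 ^ (m + 1) = 2 ^ (n - 1) := by
  induction m with
  | zero =>
    intro n hn hnm
    obtain ⟨l, rfl⟩ : ∃ l, n = l + 2 := ⟨n - 2, by simp at hnm; omega⟩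
    have hl : Even l := by simpa [Nat.even_add_one] using hn
    refine ⟨Fin l → Bool, inferInstance, _, segmentedCycles_sweepCycle hl, ?_⟩
    simp [pow_succ]
  | succ m ih =>
    intro n hn hnm
    rw [pow_succ] at hnm
    -- Removing a `4`-cube would leave dimension `0` here, where there are no cycles to use.
    by_cases h4 : n = 4
    · subst h4
      have hm : m = 0 := by
        by_contra hm
        have : 2 ^ 2 ≤ 2 ^ (m + 1) := Nat.pow_le_pow_right (by omega) (by omega)
        omega
      subst hm
      exact ⟨Bool, inferInstance, _, segmentedCycles_hamiltonian, by simp⟩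
    · have hk : 2 ^ (m + 1) = 2 ∨ 4 ∣ 2 ^ (m + 1) := by
        rcases m with _ | m
        · simp
        · exact Or.inr (pow_dvd_pow 2 (show 2 ≤ m + 1 + 1 by omega))
      have hk0 : 0 < 2 ^ (m + 1) := by positivity
      obtain ⟨l, rfl⟩ : ∃ l, n = 4 + l := ⟨n - 4, by omega⟩
      have hl : Even l := by
        rw [Nat.even_add] at hn
        exact hn.1 (by decide)
      -- Since `l` is even and nonzero, `l ≥ 2`; this and `2 ^ (m + 1) ≤ (4 + l) / 2` give the
      -- required bound, with evenness of the power used at `l = 2`.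
      obtain ⟨ι, _, c, hc, hcard⟩ := ih l hl (by obtain ⟨s, rfl⟩ := hl; omega)
      have hprod := hc.prod ⟨0, by omega⟩ hk hk0
      rw [mul_comm 2, ← pow_succ] at hprod
      refine ⟨Bool × Bool × Bool × ι, inferInstance, _, hprod, ?_⟩
      simp only [Fintype.card_prod, Fintype.card_bool]
      rw [show 4 + l - 1 = (l - 1) + 4 by omega, pow_add 2 (l - 1), ← hcard]
      ring

theorem theorem1p6 (n m : ℕ) (hn : Even n) (hm : 1 ≤ m) (hnm : 2 ^ m ≤ n) :
    ∃ (C : Fin (2 ^ (n - 1 - m)) → (cube n).Subgraph)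
      (e : Fin (2 ^ (n - 1 - m)) → Fin (2 ^ m) → Sym2 (Fin n → Bool)),
      IsDecomposition C ∧
      (∀ i, IsCycleOfLength (C i).coe (2 ^ m * n)) ∧
      (∀ i, Function.Injective (e i) ∧
        (∀ j, e i j ∈ (C i).edgeSet) ∧
        Nat.card ((C i).deleteEdges (Set.range (e i))).coe.ConnectedComponent = 2 ^ m ∧
        ∀ c : ((C i).deleteEdges (Set.range (e i))).coe.ConnectedComponent,
          IsPathOfLength c.toSimpleGraph (n - 1)) ∧
      ∃ M : (cube n).Subgraph,
        M.edgeSet = {f | ∃ i j, f = e i j} ∧ M.IsPerfectMatching := by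
  obtain ⟨m, rfl⟩ : ∃ l, m = l + 1 := ⟨m - 1, by omega⟩
  obtain ⟨ι, _, c, hc, hcard⟩ := exists_segmentedCycles m n hn hnm
  have hk : 2 ≤ 2 ^ (m + 1) := by
    rw [pow_succ]
    have := Nat.one_le_two_pow (n := m)
    omega
  -- This ensures `m + 1 ≤ n - 1`, so the subtraction in the exponent is not truncated.
  have hlt : m + 1 < 2 ^ (m + 1) := Nat.lt_two_pow_self
  have hr : 2 ^ (n - 1 - (m + 1)) * 2 ^ (m + 1) = 2 ^ (n - 1) := by
    rw [← pow_add, Nat.sub_add_cancel (by omega)]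
  refine decomposition_of_segmentedCycles hc (by omega) (by omega) ?_ hr
    (Nat.eq_of_mul_eq_mul_right (by omega) (hcard.trans hr.symm))
  calc 3 ≤ 2 * 2 := by norm_num
    _ ≤ _ := Nat.mul_le_mul hk (hk.trans hnm)
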